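/- Let $A$ be a unital commutative $\mathbb{R}$-algebra and let $X(A)$ be the set of all unital $\mathbb{R}$-algebra homomorphisms $A\to\mathbb{R}$, endowed with the weakest topology for which all evaluations $\hat a\colon\alpha\mapsto\alpha(a)$, $a\in A$, are continuous, and with its Borel $\sigma$-algebra. A Radon measure on $X(A)$ is a nonnegative, locally finite Borel measure that is inner regular with respect to compact sets. It is called a representing measure for a linear functional $L\colon A\to\mathbb{R}$ if every $\hat a$ is $\nu$-integrable and $L(a)=\int\hat a\,d\nu$ for all $a\in A$. We say that $\nu$ is supported in a Borel set $C$ if $\nu(X(A)\setminus C)=0$. The same terminology is used for every subalgebra $S\subseteq A$ and $X(S)$. A set $Q\subseteq A$ is a quadratic module if $1\in Q$, $Q+Q\subseteq Q$ and $a^2Q\subseteq Q$ for all $a\in A$; put $K_Q:=\{\alpha\in X(A):\alpha(a)\ge 0\ \forall a\in Q\}$ and, for a subalgebra $S$, $K_{Q\cap S}:=\{\alpha\in X(S):\alpha(a)\ge 0\ \forall a\in Q\cap S\}$. A seminorm $p$ on a real vector space $V$ is Hilbertian if $p(v)=\sqrt{\langle v,v\rangle_p}$ for a symmetric positive semidefinite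 bilinear form $\langle\cdot,\cdot\rangle_p$ on $V$. For Hilbertian seminorms $p,q$ on $V$ let $\mathrm{tr}(p/q):=\sup_E\sum_{e\in E}p(e)^2\in[0,\infty]$, the supremum being over all finite $q$-orthonormal sets $E\subseteq V$, if $\ker q\subseteq\ker p$, and $\mathrm{tr}(p/q):=\infty$ otherwise. The space $(V,\tau_V)$ is nuclear if $\tau_V$ is induced by a directed family $\mathcal{P}$ of Hilbertian seminorms such that for each $p\in\mathcal{P}$ there is $q\in\mathcal{P}$ with $\mathrm{tr}(p/q)<\infty$. A linear functional $\ell$ on $V$ is $q$-continuous if there is $C>0$ with $|\ell(v)|\le C\,q(v)$ for all $v\in V$. **Statement.** Let $V$ be a linear subspace of $A$ that generates $A$ as a unital algebra, and let $\tau_V$ be a topology on $V$ such that $(V,\tau_V)$ is nuclear. Let $Q\subseteq A$ be a quadratic module, let $K\subseteq X(A)$ be closed with $K=K_Q$, and let $L\colon A\to\mathbb{R}$ be a linear functional with $L(1)=1$ that is nonnegative on all finite sums of squares of elements of $A$. Put $s_L(a):=\sqrt{L(a^2)}$, a Hilbertian seminorm on $A$. Assume that 1. for every subalgebra $S$ of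 $A$ generated by a finite-dimensional subspace of $V$, the restriction $L|_S$ has a representing Radon measure on $X(S)$ supported in $K_{Q\cap S}$; 2. $s_L|_V$ is $\tau_V$-continuous. Then for every Hilbertian seminorm $q$ on $V$ such that $\mathrm{tr}(s_L|_V/q)<\infty$ and $\{\alpha\in K_Q:\alpha|_V\text{ is }q\text{-continuous}\}\neq\emptyset$, there exists a representing Radon measure for $L$ supported in $\{\alpha\in K:\alpha|_V\text{ is }q\text{-continuous}\}$. -/

import Mathlib

open MeasureTheory
open scoped ENNReal

noncomputable section

namespace MomentProblem

/-! ### Hilbertian seminorms, traces and nuclear spaces -/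

section Hilbertian

variable {E : Type*} [AddCommGroup E] [Module ℝ E]

/-- A seminorm is Hilbertian if it is induced by a symmetric positive semidefinite bilinear
form. -/
def IsHilbertian (p : Seminorm ℝ E) : Prop :=
  ∃ B : LinearMap.BilinForm ℝ E, B.IsPosSemidef ∧ ∀ v, p v = √(B v v)

/-- The symmetric form `⟨v, w⟩_q` of a seminorm `q`, given by polarization; for a Hilbertian `q`
this is the unique bilinear form inducing `q`. -/
def polarForm (q : Seminorm ℝ E) (v w : E) : ℝ :=
  (q (v + w) ^ 2 - q v ^ 2 - q w ^ 2) / 2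

/-- Finite `q`-orthonormal subsets. -/
def IsFON (q : Seminorm ℝ E) (F : Finset E) : Prop :=
  (∀ e ∈ F, ∀ f ∈ F, e ≠ f → polarForm q e f = 0) ∧ ∀ e ∈ F, q e = 1

open Classical in
/-- The trace `tr(p/q)` of `p` with respect to `q`, an extended nonnegative real. -/
def trace (p q : Seminorm ℝ E) : ℝ≥0∞ :=
  if ∀ v, q v = 0 → p v = 0 then
    ⨆ (F : Finset E) (_ : IsFON q F), ∑ e ∈ F, ENNReal.ofReal (p e ^ 2)
  else ∞

variable (E) in
/-- A topology on a real vector space is nuclear if it is induced by a directed family `P` of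
Hilbertian seminorms such that every `p ∈ P` has finite trace with respect to some `q ∈ P`. -/
def IsNuclear [TopologicalSpace E] : Prop :=
  ∃ P : Set (Seminorm ℝ E),
    (∀ p ∈ P, IsHilbertian p) ∧
    DirectedOn (· ≤ ·) P ∧
    WithSeminorms (fun p : P => (p : Seminorm ℝ E)) ∧
    ∀ p ∈ P, ∃ q ∈ P, trace p q < ∞

/-- The seminorm `v ↦ √(B v v)` of a symmetric positive semidefinite bilinear form. -/
def seminormOfForm (B : LinearMap.BilinForm ℝ E) (hB : B.IsPosSemidef) : Seminorm ℝ E :=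
  Seminorm.of (fun v => √(B v v))
    (by
      intro x y
      have hx : 0 ≤ B x x := hB.isNonneg.nonneg x
      have hy : 0 ≤ B y y := hB.isNonneg.nonneg y
      have hs : B y x = B x y := hB.isSymm.eq y x
      have hcs : B x y * B y x ≤ B x x * B y y :=
        LinearMap.BilinForm.apply_mul_apply_le_of_forall_zero_le B hB.isNonneg.nonneg x y
      rw [hs] at hcs
      have hxy : B x y ≤ √(B x x) * √(B y y) := by
        rw [← Real.sqrt_mul hx]
        exact Real.le_sqrt_of_sq_le (by nlinarith)
      apply Real.sqrt_le_iff.mpr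
      refine ⟨by positivity, ?_⟩
      have h1 := Real.sq_sqrt hx
      have h2 := Real.sq_sqrt hy
      simp only [map_add, LinearMap.add_apply]
      nlinarith)
    (by
      intro a x
      simp only [map_smul, LinearMap.smul_apply, smul_eq_mul]
      rw [← mul_assoc, Real.sqrt_mul (mul_self_nonneg a), Real.sqrt_mul_self_eq_abs,
        Real.norm_eq_abs])

end Hilbertian

/-! ### Quadratic modules, positive functionals and the character space -/

section Algebra

variable {A : Type*} [CommRing A] [Algebra ℝ A]

/-- `Q` is a quadratic module: `1 ∈ Q`, `Q + Q ⊆ Q`, `A² Q ⊆ Q`. -/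
structure IsQuadraticModule (Q : Set A) : Prop where
  one_mem : (1 : A) ∈ Q
  add_mem : ∀ a ∈ Q, ∀ b ∈ Q, a + b ∈ Q
  sq_mul_mem : ∀ a, ∀ b ∈ Q, a ^ 2 * b ∈ Q

/-- `L` is nonnegative on sums of squares. -/
def SumSqPositive (L : A →ₗ[ℝ] ℝ) : Prop := ∀ a, IsSumSq a → 0 ≤ L a

/-- The form `(a, b) ↦ L (a * b)`. -/
def mulForm (L : A →ₗ[ℝ] ℝ) : LinearMap.BilinForm ℝ A := (LinearMap.mul ℝ A).compr₂ L

theorem mulForm_apply (L : A →ₗ[ℝ] ℝ) (a b : A) : mulForm L a b = L (a * b) := rfl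

theorem mulForm_isPosSemidef {L : A →ₗ[ℝ] ℝ} (hL : SumSqPositive L) :
    (mulForm L).IsPosSemidef where
  eq a b := by simp [mulForm_apply, mul_comm]
  nonneg a := hL _ (IsSumSq.mul_self a)

/-- The Hilbertian seminorm `s_L(a) = √(L(a²))`. -/
def sL (L : A →ₗ[ℝ] ℝ) (hL : SumSqPositive L) : Seminorm ℝ A :=
  seminormOfForm (mulForm L) (mulForm_isPosSemidef hL)

theorem sL_apply (L : A →ₗ[ℝ] ℝ) (hL : SumSqPositive L) (a : A) :
    sL L hL a = √(L (a ^ 2)) := by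
  rw [pow_two]; rfl

variable (A) in
/-- The character space `X(A)`: all unital `ℝ`-algebra homomorphisms `A → ℝ`. -/
def CharSp : Type _ := A →ₐ[ℝ] ℝ

instance : FunLike (CharSp A) A ℝ := inferInstanceAs (FunLike (A →ₐ[ℝ] ℝ) A ℝ)

instance : AlgHomClass (CharSp A) ℝ A ℝ := inferInstanceAs (AlgHomClass (A →ₐ[ℝ] ℝ) ℝ A ℝ)

/-- The weakest topology on `X(A)` making all evaluations `α ↦ α a` continuous. -/
instance : TopologicalSpace (CharSp A) :=
  TopologicalSpace.induced (fun α : CharSp A => (α : A → ℝ)) inferInstance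

instance : MeasurableSpace (CharSp A) := borel _

instance : BorelSpace (CharSp A) := ⟨rfl⟩

/-- `K_Q`: the characters that are nonnegative on `Q`. -/
def nonnegSet (Q : Set A) : Set (CharSp A) := {α | ∀ a ∈ Q, 0 ≤ α a}

/-- `ν` is a representing Radon measure for `L` that is supported in `C`, that is, `ν` is a
locally finite Borel measure that is inner regular with respect to compact sets, every evaluation
is integrable with integral `L a`, and the complement of `C` is a null set. -/
structure IsRepresentingOn (L : A →ₗ[ℝ] ℝ) (ν : Measure (CharSp A)) (C : Set (CharSp A)) :
    Prop where
  locallyFinite : IsLocallyFiniteMeasure ν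
  innerRegular : ν.InnerRegular
  integrable : ∀ a, Integrable (fun α : CharSp A => α a) ν
  integral_eq : ∀ a, L a = ∫ α, α a ∂ν
  null_compl : ν Cᶜ = 0

/-- The set `J` of all subalgebras generated by a finite-dimensional subspace of `V`. -/
def finGenSubalgebras (V : Submodule ℝ A) : Set (Subalgebra ℝ A) :=
  {S | ∃ W : Submodule ℝ A, W ≤ V ∧ FiniteDimensional ℝ W ∧ S = Algebra.adjoin ℝ (W : Set A)}

/-- The restriction of `α` to `V` is `q`-continuous. -/
def IsContinuousOn (V : Submodule ℝ A) (q : Seminorm ℝ V) (α : CharSp A) : Prop :=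
  ∃ C : ℝ, 0 < C ∧ ∀ v : V, |α (v : A)| ≤ C * q v

end Algebra

end MomentProblem

end

noncomputable section

namespace MomentProblem

open Topology Filter

/-! ### Character spaces and the compact space of extended-real functions -/

section CharacterTopology

variable {A : Type*} [CommRing A] [Algebra ℝ A]

/-! The representing measures on the subalgebras generated by finite sets `F ⊆ V` are not assumed
compatible, so a compactness argument replaces a projective limit. Each is extended by zero to the
compact space `EReal ^ A`, and a limit `μ` is taken along an ultrafilter finer than `atTop` on the
finite sets.

Mass could escape from the genuine characters. `measure_compl_boundedSet_le` prevents this: by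
Gram-Schmidt, Chebyshev and Cauchy-Schwarz, the characters violating `|α f| ≤ n * q f` for some `f ∈
F` have mass at most `tr(s_L/q) / n²`, whatever `F` is. The remaining conditions are closed and
decrease with `F`, so `measure_compl_iInter_le` passes the bound to `μ` and
`iInter_cylinderSet_subset` glues the local characters. Letting `n → ∞`, `μ` lives on a σ-compact
set of `q`-continuous characters in `K_Q`.

Moments survive because truncation at level `n` changes the integral of `a` by at most `L (a ^ 2) /
n`, uniformly in `F` (`abs_integral_trunc_sub_le`, `integrable_and_integral_eq_of_trunc`). -/

theorem CharSp.continuous_eval (a : A) : Continuous fun α : CharSp A => α a :=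
  (continuous_apply a).comp continuous_induced_dom

theorem CharSp.isEmbedding_coe : IsEmbedding (fun α : CharSp A => (α : A → ℝ)) :=
  ⟨⟨rfl⟩, DFunLike.coe_injective⟩

/-- The axioms of a unital algebra homomorphism are equations between finitely many coordinates
each, hence closed conditions. -/
theorem CharSp.isClosedEmbedding_coe :
    IsClosedEmbedding (fun α : CharSp A => (α : A → ℝ)) := by
  refine ⟨CharSp.isEmbedding_coe, ?_⟩
  have h : Set.range (fun α : CharSp A => (α : A → ℝ)) =
      {x | ∀ a b, x (a + b) = x a + x b} ∩ ({x | ∀ a b, x (a * b) = x a * x b} ∩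
        {x | ∀ r : ℝ, x (algebraMap ℝ A r) = r}) := by
    ext x
    constructor
    · rintro ⟨α, rfl⟩
      exact ⟨fun a b => map_add α a b, fun a b => map_mul α a b, fun r => AlgHomClass.commutes α r⟩
    · rintro ⟨hadd, hmul, halg⟩
      refine ⟨({ toFun := x
                 map_one' := by simpa using halg 1
                 map_mul' := hmul
                 map_zero' := by simpa using halg 0
                 map_add' := hadd
                 commutes' := halg } : A →ₐ[ℝ] ℝ), rfl⟩
  rw [h]
  simp only [Set.ofPred_forall]
  refine IsClosed.inter ?_ (IsClosed.inter ?_ ?_)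
  · exact isClosed_iInter fun a => isClosed_iInter fun b =>
      isClosed_eq (by fun_prop) (by fun_prop)
  · exact isClosed_iInter fun a => isClosed_iInter fun b =>
      isClosed_eq (by fun_prop) (by fun_prop)
  · exact isClosed_iInter fun a => isClosed_eq (by fun_prop) (by fun_prop)

theorem isClosed_nonnegSet (Q : Set A) : IsClosed (nonnegSet Q) := by
  simp only [nonnegSet, Set.ofPred_forall]
  exact isClosed_iInter fun a => isClosed_iInter fun _ =>
    isClosed_le continuous_const (CharSp.continuous_eval a)

/-- Bounds on generators propagate through sums and products to every element, so the set is closed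
inside a product of compact intervals and Tychonoff applies. -/
theorem CharSp.isCompact_setOf_abs_le {G : Set A} (hG : Algebra.adjoin ℝ G = ⊤) (c : A → ℝ) :
    IsCompact {α : CharSp A | ∀ g ∈ G, |α g| ≤ c g} := by
  have hb : ∀ a : A, ∃ M : ℝ, ∀ α : CharSp A, (∀ g ∈ G, |α g| ≤ c g) → |α a| ≤ M := by
    intro a
    have ha : a ∈ Algebra.adjoin ℝ G := hG ▸ Algebra.mem_top
    induction ha using Algebra.adjoin_induction with
    | mem x hx => exact ⟨c x, fun α h => h x hx⟩
    | algebraMap r => exact ⟨|r|, fun α _ => by rw [AlgHomClass.commutes]; exact le_rfl⟩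
    | add x y _ _ hx hy =>
      obtain ⟨M, hM⟩ := hx
      obtain ⟨N, hN⟩ := hy
      refine ⟨M + N, fun α h => ?_⟩
      rw [map_add]
      exact (abs_add_le _ _).trans (add_le_add (hM α h) (hN α h))
    | mul x y _ _ hx hy =>
      obtain ⟨M, hM⟩ := hx
      obtain ⟨N, hN⟩ := hy
      refine ⟨M * N, fun α h => ?_⟩
      rw [map_mul, abs_mul]
      exact mul_le_mul (hM α h) (hN α h) (abs_nonneg _) ((abs_nonneg _).trans (hM α h))
  choose M hM using hb
  have hK : IsCompact (Set.univ.pi fun a : A => Set.Icc (-M a) (M a)) :=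
    isCompact_univ_pi fun a => isCompact_Icc
  refine (CharSp.isClosedEmbedding_coe.isCompact_preimage hK).of_isClosed_subset ?_ ?_
  · simp only [Set.ofPred_forall]
    exact isClosed_iInter fun a => isClosed_iInter fun _ =>
      isClosed_le (CharSp.continuous_eval a).abs continuous_const
  · intro α hα a _
    exact abs_le.mp (hM a α hα)

/-- The compact space of extended-real valued functions on `A`, with its Borel `σ`-algebra. -/
def ExtSp (A : Type*) : Type _ := A → EReal

instance (A : Type*) : TopologicalSpace (ExtSp A) := inferInstanceAs (TopologicalSpace (A → EReal))

instance (A : Type*) : CompactSpace (ExtSp A) := inferInstanceAs (CompactSpace (A → EReal))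

instance (A : Type*) : T2Space (ExtSp A) := inferInstanceAs (T2Space (A → EReal))

instance (A : Type*) : MeasurableSpace (ExtSp A) := borel _

instance (A : Type*) : BorelSpace (ExtSp A) := ⟨rfl⟩

/-- The coordinate functions of `ExtSp A`. -/
def ExtSp.eval {A : Type*} (a : A) (y : ExtSp A) : EReal := y a

theorem ExtSp.ext {A : Type*} {y z : ExtSp A} (h : ∀ a, y.eval a = z.eval a) : y = z := funext h

theorem ExtSp.continuous_eval {A : Type*} (a : A) : Continuous (ExtSp.eval a) :=
  continuous_apply (A := fun _ : A => EReal) a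

theorem ExtSp.continuous_iff {A X : Type*} [TopologicalSpace X] {f : X → ExtSp A} :
    Continuous f ↔ ∀ a, Continuous fun x => (f x).eval a :=
  continuous_pi_iff (A := fun _ : A => EReal)

/-- Restriction to a subalgebra. -/
def ExtSp.restrict (S : Subalgebra ℝ A) (y : ExtSp A) : ExtSp S := fun s : S => ExtSp.eval (A := A) s y

theorem ExtSp.restrict_eval (S : Subalgebra ℝ A) (y : ExtSp A) (s : S) :
    (y.restrict S).eval s = ExtSp.eval (s : A) y := rfl

theorem ExtSp.continuous_restrict (S : Subalgebra ℝ A) : Continuous (ExtSp.restrict S) :=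
  ExtSp.continuous_iff.mpr fun s => ExtSp.continuous_eval (s : A)

/-- A character, viewed as an extended-real valued function. -/
def CharSp.toExtSp (α : CharSp A) : ExtSp A := fun a => ((α a : ℝ) : EReal)

theorem CharSp.toExtSp_eval (α : CharSp A) (a : A) : α.toExtSp.eval a = ((α a : ℝ) : EReal) := rfl

theorem CharSp.isEmbedding_toExtSp : IsEmbedding (CharSp.toExtSp (A := A)) :=
  (IsEmbedding.piMap fun _ : A => EReal.isEmbedding_coe).comp CharSp.isEmbedding_coe

open Classical in
/-- Extension by zero of a character of a subalgebra to an extended-real valued function. -/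
def CharSp.extend (S : Subalgebra ℝ A) (α : CharSp S) : ExtSp A := fun a =>
  if h : a ∈ S then ((α ⟨a, h⟩ : ℝ) : EReal) else 0

theorem CharSp.extend_eval {S : Subalgebra ℝ A} (α : CharSp S) {a : A} (h : a ∈ S) :
    (CharSp.extend S α).eval a = ((α ⟨a, h⟩ : ℝ) : EReal) := by
  simp [CharSp.extend, ExtSp.eval, h]

theorem CharSp.restrict_extend {S : Subalgebra ℝ A} (α : CharSp S) :
    (CharSp.extend S α).restrict S = α.toExtSp :=
  ExtSp.ext fun s => CharSp.extend_eval α s.2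

theorem CharSp.continuous_extend (S : Subalgebra ℝ A) : Continuous (CharSp.extend S) := by
  refine ExtSp.continuous_iff.mpr fun a => ?_
  by_cases h : a ∈ S
  · simp only [CharSp.extend_eval _ h]
    exact continuous_coe_real_ereal.comp (CharSp.continuous_eval (⟨a, h⟩ : S))
  · simpa [CharSp.extend, ExtSp.eval, h] using continuous_const

/-- Restriction of a character to a smaller subalgebra. -/
def CharSp.restrictLE {S T : Subalgebra ℝ A} (h : S ≤ T) (α : CharSp T) : CharSp S :=
  AlgHom.comp (show T →ₐ[ℝ] ℝ from α) (Subalgebra.inclusion h)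

theorem CharSp.restrictLE_apply {S T : Subalgebra ℝ A} (h : S ≤ T) (α : CharSp T) (s : S) :
    α.restrictLE h s = α ⟨s, h s.2⟩ := rfl

end CharacterTopology

/-! ### Gram-Schmidt and Bessel for semidefinite forms -/

section GramSchmidt

variable {E : Type*} [AddCommGroup E] [Module ℝ E]

theorem polarForm_eq {q : Seminorm ℝ E} {B : LinearMap.BilinForm ℝ E} (hB : B.IsPosSemidef)
    (hq : ∀ v, q v = √(B v v)) (v w : E) : polarForm q v w = B v w := by
  have h : ∀ x, q x ^ 2 = B x x := fun x => by
    rw [hq, Real.sq_sqrt (hB.isNonneg.nonneg x)]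
  have hs : B w v = B v w := hB.isSymm.eq w v
  rw [polarForm, h, h, h]
  simp only [map_add, LinearMap.add_apply, hs]
  ring

/-- Gram-Schmidt for a possibly degenerate form: every vector of `F` is, up to a `q`-null vector,
its orthogonal projection onto the span of a finite `q`-orthonormal subset of `span F`. -/
theorem exists_isFON {q : Seminorm ℝ E} {B : LinearMap.BilinForm ℝ E} (hB : B.IsPosSemidef)
    (hq : ∀ v, q v = √(B v v)) (F : Finset E) :
    ∃ G : Finset E, IsFON q G ∧ (G : Set E) ⊆ Submodule.span ℝ (F : Set E) ∧
      ∀ f ∈ F, q (f - ∑ e ∈ G, B f e • e) = 0 := by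
  classical
  have hpf := polarForm_eq hB hq
  have hsymm : ∀ v w, B v w = B w v := fun v w => hB.isSymm.eq v w
  have hsq : ∀ x, q x ^ 2 = B x x := fun x => by
    rw [hq, Real.sq_sqrt (hB.isNonneg.nonneg x)]
  induction F using Finset.induction_on with
  | empty => exact ⟨∅, ⟨by simp, by simp⟩, by simp, by simp⟩
  | insert g F hg ih =>
    obtain ⟨G, hG, hGF, hF⟩ := ih
    have hle : Submodule.span ℝ (F : Set E) ≤ Submodule.span ℝ ((insert g F : Finset E) : Set E) :=
      Submodule.span_mono (by simp)
    set k := g - ∑ e ∈ G, B g e • e with hk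
    -- The form may be degenerate: a nonzero residual of `q`-length zero cannot be normalized, but
    -- needs no new basis vector either.
    by_cases hk0 : q k = 0
    · refine ⟨G, hG, hGF.trans hle, fun f hf => ?_⟩
      rcases Finset.mem_insert.mp hf with rfl | hf
      · exact hk0
      · exact hF f hf
    · have horth : ∀ e ∈ G, B k e = 0 := by
        intro e he
        rw [hk, map_sub, LinearMap.sub_apply, map_sum, LinearMap.sum_apply,
          Finset.sum_eq_single e]
        · have : B e e = 1 := by rw [← hsq, hG.2 e he]; norm_num
          simp [this]
        · intro e' he' hne
          have := hG.1 e' he' e he hne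
          rw [hpf] at this
          simp [this]
        · exact fun h => absurd he h
      set u := (q k)⁻¹ • k with hu
      have hqu : q u = 1 := by
        rw [hu, map_smul_eq_mul, norm_inv, Real.norm_of_nonneg (apply_nonneg q k),
          inv_mul_cancel₀ hk0]
      have huu : B u u = 1 := by rw [← hsq, hqu]; norm_num
      have hue : ∀ e ∈ G, B u e = 0 := fun e he => by simp [hu, horth e he]
      have huG : u ∉ G := fun h => by
        have := hue u h
        rw [huu] at this
        exact one_ne_zero this
      have hkspan : k ∈ Submodule.span ℝ ((insert g F : Finset E) : Set E) := by
        refine Submodule.sub_mem _ (Submodule.subset_span (by simp)) ?_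
        exact Submodule.sum_mem _ fun e he => Submodule.smul_mem _ _ (hle (hGF he))
      have hgu : B g u • u = k := by
        have h1 : B k k = B g k := by
          have : B (∑ e ∈ G, B g e • e) k = 0 := by
            rw [map_sum, LinearMap.sum_apply]
            refine Finset.sum_eq_zero fun e he => ?_
            rw [map_smul, LinearMap.smul_apply, hsymm e k, horth e he, smul_zero]
          have h : B (g - ∑ e ∈ G, B g e • e) k = B g k - B (∑ e ∈ G, B g e • e) k := by
            rw [LinearMap.map_sub B, LinearMap.sub_apply]
          rw [this, sub_zero, ← hk] at h
          exact h
        have h2 : B g u = q k := by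
          rw [hu, map_smul, ← h1, ← hsq, smul_eq_mul]
          field_simp
        rw [h2, hu, smul_smul, mul_inv_cancel₀ hk0, one_smul]
      refine ⟨insert u G, ⟨?_, ?_⟩, ?_, ?_⟩
      · intro e he f hf hne
        rw [hpf]
        rcases Finset.mem_insert.mp he with rfl | he <;> rcases Finset.mem_insert.mp hf with rfl | hf
        · exact absurd rfl hne
        · exact hue f hf
        · rw [hsymm]; exact hue e he
        · rw [← hpf]; exact hG.1 e he f hf hne
      · intro e he
        rcases Finset.mem_insert.mp he with rfl | he
        · exact hqu
        · exact hG.2 e he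
      · intro e he
        rcases Finset.mem_insert.mp (Finset.mem_coe.mp he) with rfl | he
        · exact Submodule.smul_mem _ _ hkspan
        · exact hle (hGF he)
      · intro f hf
        rw [Finset.sum_insert huG]
        rcases Finset.mem_insert.mp hf with rfl | hf
        · rw [hgu, hk]
          simp
        -- The old residual of `f` is `q`-null, hence orthogonal to `u` by Cauchy-Schwarz, and `u`
        -- is orthogonal to `G`. Adding `u` therefore leaves the projection of `f` unchanged.
        · have h0 : B f u = 0 := by
            have hr : B (f - ∑ e ∈ G, B f e • e) u = 0 := by
              have hcs := LinearMap.BilinForm.apply_mul_apply_le_of_forall_zero_le B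
                hB.isNonneg.nonneg (f - ∑ e ∈ G, B f e • e) u
              rw [hsymm u, ← hsq (f - _), hF f hf] at hcs
              nlinarith
            rw [map_sub, LinearMap.sub_apply, map_sum, LinearMap.sum_apply] at hr
            rw [Finset.sum_eq_zero, sub_zero] at hr
            · exact hr
            · intro e he
              rw [hsymm, LinearMap.map_smul (B u), hue e he, smul_zero]
          rw [h0, zero_smul, zero_add]
          exact hF f hf

/-- Bessel's inequality: expand the nonnegative value of the form at `f` minus its projection. -/
theorem sum_sq_le_of_isFON {q : Seminorm ℝ E} {B : LinearMap.BilinForm ℝ E} (hB : B.IsPosSemidef)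
    (hq : ∀ v, q v = √(B v v)) {G : Finset E} (hG : IsFON q G) (f : E) :
    ∑ e ∈ G, B f e ^ 2 ≤ q f ^ 2 := by
  classical
  have hpf := polarForm_eq hB hq
  have hsymm : ∀ v w, B v w = B w v := fun v w => hB.isSymm.eq v w
  have hsq : ∀ x, q x ^ 2 = B x x := fun x => by
    rw [hq, Real.sq_sqrt (hB.isNonneg.nonneg x)]
  have hp : B (∑ e ∈ G, B f e • e) (∑ e ∈ G, B f e • e) = ∑ e ∈ G, B f e ^ 2 := by
    rw [map_sum]
    refine Finset.sum_congr rfl fun e he => ?_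
    rw [map_smul, hsymm (∑ e ∈ G, B f e • e) e, map_sum, Finset.sum_eq_single e]
    · have : B e e = 1 := by rw [← hsq, hG.2 e he]; norm_num
      simp [this, sq]
    · intro e' he' hne
      have := hG.1 e he e' he' hne.symm
      rw [hpf] at this
      rw [map_smul, this, smul_zero]
    · exact fun h => absurd he h
  have hm : B f (∑ e ∈ G, B f e • e) = ∑ e ∈ G, B f e ^ 2 := by
    rw [map_sum]
    exact Finset.sum_congr rfl fun e _ => by simp [sq]
  have h0 := hB.isNonneg.nonneg (f - ∑ e ∈ G, B f e • e)
  simp only [map_sub, LinearMap.sub_apply] at h0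
  rw [hsymm (∑ e ∈ G, B f e • e) f, hp, hm] at h0
  rw [hsq]
  linarith

end GramSchmidt

/-! ### The uniform tail estimate from the trace -/

section Tightness

variable {A : Type*} [CommRing A] [Algebra ℝ A] {V : Submodule ℝ A}

/-- The characters of `S` that are bounded by `n * q` on `F ∩ S`. -/
def boundedSet (S : Subalgebra ℝ A) (q : Seminorm ℝ V) (F : Set V) (n : ℝ) : Set (CharSp S) :=
  {α | ∀ v ∈ F, ∀ h : (v : A) ∈ S, |α ⟨v, h⟩| ≤ n * q v}

theorem isClosed_boundedSet (S : Subalgebra ℝ A) (q : Seminorm ℝ V) (F : Set V) (n : ℝ) :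
    IsClosed (boundedSet S q F n) := by
  simp only [boundedSet, Set.ofPred_forall]
  exact isClosed_iInter fun v => isClosed_iInter fun _ => isClosed_iInter fun h =>
    isClosed_le (CharSp.continuous_eval _).abs continuous_const

open Classical in
theorem isCompact_boundedSet (q : Seminorm ℝ V) (F : Set V) (n : ℝ) :
    IsCompact (boundedSet (Algebra.adjoin ℝ ((↑) '' F : Set A)) q F n) := by
  refine (CharSp.isCompact_setOf_abs_le
    (Algebra.adjoin_adjoin_coe_preimage (R := ℝ) (s := ((↑) '' F : Set A)))
    (fun s => if h : (s : A) ∈ V then n * q ⟨s, h⟩ else 0)).of_isClosed_subset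
    (isClosed_boundedSet _ q F n) ?_
  rintro α hα ⟨s, hs⟩ ⟨v, hv, rfl⟩
  simpa using hα v hv hs

open Classical in
theorem isCompact_setOf_abs_le_seminorm (hV : Algebra.adjoin ℝ (V : Set A) = ⊤)
    (q : Seminorm ℝ V) (n : ℝ) : IsCompact {α : CharSp A | ∀ v : V, |α v| ≤ n * q v} := by
  convert CharSp.isCompact_setOf_abs_le hV
    (fun a => if h : a ∈ V then n * q ⟨a, h⟩ else 0) using 1
  ext α
  constructor
  · intro h g hg
    simpa [show g ∈ V from hg] using h ⟨g, hg⟩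
  · intro h v
    simpa using h v v.2

theorem isFiniteMeasure_of_isRepresentingOn {L : A →ₗ[ℝ] ℝ} {ν : Measure (CharSp A)}
    {C : Set (CharSp A)} (h : IsRepresentingOn L ν C) : IsFiniteMeasure ν := by
  have := h.integrable 1
  simp only [map_one] at this
  simpa [integrable_const_iff] using this

theorem isProbabilityMeasure_of_isRepresentingOn {L : A →ₗ[ℝ] ℝ} {ν : Measure (CharSp A)}
    {C : Set (CharSp A)} (h : IsRepresentingOn L ν C) (hL : L 1 = 1) :
    IsProbabilityMeasure ν := by
  have := isFiniteMeasure_of_isRepresentingOn h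
  have h1 := h.integral_eq 1
  simp only [hL, map_one, integral_const, smul_eq_mul, mul_one] at h1
  constructor
  rw [← ENNReal.ofReal_toReal (measure_ne_top ν Set.univ)]
  change ENNReal.ofReal (ν.real Set.univ) = 1
  rw [← h1, ENNReal.ofReal_one]

/-- With `G` a `q`-orthonormal set obtained from `F`, put `T α = ∑ e ∈ G, (α e)²`. Its mean is `∑
s_L(e)²`, at most the trace. Almost surely `α f = ∑ B f e * α e`, so `T α < n²` forces `|α f| ≤ n *
q f` by Cauchy-Schwarz and Bessel; Chebyshev bounds the rest. The bound does not depend on `F` or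
`S`. -/
theorem measure_compl_boundedSet_le {L : A →ₗ[ℝ] ℝ} (hL : SumSqPositive L) {q : Seminorm ℝ V}
    (hq : IsHilbertian q) (htr : trace ((sL L hL).comp V.subtype) q < ⊤) (S : Subalgebra ℝ A)
    {ν : Measure (CharSp S)} {C : Set (CharSp S)}
    (hν : IsRepresentingOn (L ∘ₗ S.val.toLinearMap) ν C) (F : Finset V)
    (hF : ∀ f ∈ F, (f : A) ∈ S) {n : ℝ} (hn : 0 < n) :
    ν (boundedSet S q F n)ᶜ ≤ trace ((sL L hL).comp V.subtype) q / ENNReal.ofReal (n ^ 2) := by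
  classical
  obtain ⟨B, hB, hqB⟩ := hq
  obtain ⟨G, hG, hGF, hres⟩ := exists_isFON hB hqB F
  have hker : ∀ v, q v = 0 → ((sL L hL).comp V.subtype) v = 0 := by
    by_contra h
    rw [trace, if_neg h] at htr
    exact lt_irrefl _ htr
  have hspan : ∀ v ∈ Submodule.span ℝ (F : Set V), (v : A) ∈ S := by
    intro v hv
    have hle : Submodule.span ℝ (F : Set V) ≤ (Subalgebra.toSubmodule S).comap V.subtype :=
      Submodule.span_le.mpr fun f hf => hF f hf
    exact hle hv
  have hGS : ∀ e ∈ G, (e : A) ∈ S := fun e he => hspan e (hGF he)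
  have hsq : ∀ v : V, ((sL L hL).comp V.subtype) v ^ 2 = L ((v : A) ^ 2) := fun v => by
    rw [Seminorm.comp_apply, Submodule.subtype_apply, sL_apply,
      Real.sq_sqrt (hL _ (by rw [sq]; exact IsSumSq.mul_self _))]
  have hint : ∀ s : S, Integrable (fun α : CharSp S => α s ^ 2) ν := fun s => by
    have := hν.integrable (s ^ 2)
    simpa only [map_pow] using this
  have hval : ∀ s : S, ∫ α : CharSp S, α s ^ 2 ∂ν = L ((s : A) ^ 2) := fun s => by
    have := hν.integral_eq (s ^ 2)
    simp only [map_pow] at this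
    rw [← this]
    simp
  set x : V → CharSp S → ℝ := fun v α => if h : (v : A) ∈ S then α ⟨v, h⟩ else 0 with hx
  have hxS : ∀ (v : V) (h : (v : A) ∈ S), x v = fun α => α ⟨v, h⟩ := fun v h => by
    funext α
    simp [hx, h]
  -- The Gram-Schmidt residuals are `q`-null, hence `s_L`-null by the kernel condition in the trace;
  -- their evaluations have second moment zero.
  have hnull : ∀ᵐ α ∂ν, ∀ f ∈ F, x (f - ∑ e ∈ G, B f e • e) α = 0 := by
    rw [Filter.eventually_all_finset]
    intro f hf
    have hk : ((f - ∑ e ∈ G, B f e • e : V) : A) ∈ S := hspan _ <|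
      Submodule.sub_mem _ (Submodule.subset_span hf) <|
        Submodule.sum_mem _ fun e he => Submodule.smul_mem _ _ (hGF he)
    have h0 := hker _ (hres f hf)
    have h1 := hval ⟨_, hk⟩
    rw [← hsq, h0, zero_pow two_ne_zero,
      integral_eq_zero_iff_of_nonneg (fun α => sq_nonneg _) (hint _)] at h1
    filter_upwards [h1] with α hα
    rw [hxS _ hk]
    exact pow_eq_zero_iff two_ne_zero |>.mp hα
  have hlin : ∀ᵐ α ∂ν, ∀ f ∈ F, x f α = ∑ e ∈ G, B f e * x e α := by
    filter_upwards [hnull] with α hα f hf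
    have h0 := hα f hf
    have hk : ((f - ∑ e ∈ G, B f e • e : V) : A) ∈ S := hspan _ <|
      Submodule.sub_mem _ (Submodule.subset_span hf) <|
        Submodule.sum_mem _ fun e he => Submodule.smul_mem _ _ (hGF he)
    have hsum : (⟨_, hk⟩ : S) = ⟨f, hF f hf⟩ - ∑ e ∈ G.attach, B f e • ⟨(e : V), hGS e e.2⟩ := by
      apply Subtype.ext
      simp only [AddSubgroupClass.coe_sub, AddSubmonoidClass.coe_finsetSum]
      congr 1
      rw [← Finset.sum_attach]
      rfl
    rw [hxS _ hk] at h0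
    simp only [hsum, map_sub, map_sum, map_smul, smul_eq_mul, sub_eq_zero] at h0
    rw [hxS _ (hF f hf)]
    refine h0.trans ?_
    rw [← Finset.sum_attach G]
    refine Finset.sum_congr rfl fun e _ => ?_
    rw [hxS _ (hGS e e.2)]
  set T : CharSp S → ℝ≥0∞ := fun α => ∑ e ∈ G, ENNReal.ofReal (x e α ^ 2) with hT
  have hxm : ∀ e ∈ G, Measurable fun α => ENNReal.ofReal (x e α ^ 2) := fun e he => by
    rw [hxS e (hGS e he)]
    exact ((CharSp.continuous_eval _).measurable.pow_const 2).ennreal_ofReal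
  have hTint : ∫⁻ α, T α ∂ν ≤ trace ((sL L hL).comp V.subtype) q := by
    rw [hT, lintegral_finsetSum _ hxm, trace, if_pos hker]
    refine le_trans (le_of_eq ?_)
      (le_iSup₂ (f := fun (G : Finset V) (_ : IsFON q G) =>
        ∑ e ∈ G, ENNReal.ofReal (((sL L hL).comp V.subtype) e ^ 2)) G hG)
    refine Finset.sum_congr rfl fun e he => ?_
    rw [hsq, ← hval ⟨e, hGS e he⟩, hxS e (hGS e he)]
    exact (ofReal_integral_eq_lintegral_ofReal (hint _)
      (Eventually.of_forall fun α => sq_nonneg _)).symm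
  have hsub : (boundedSet S q F n)ᶜ ≤ᵐ[ν] {α | ENNReal.ofReal (n ^ 2) ≤ T α} := by
    filter_upwards [hlin] with α hα hbad
    by_contra hlt
    refine hbad fun f hf hfS => ?_
    have hlt' : T α < ENNReal.ofReal (n ^ 2) := not_le.mp hlt
    have hle : ∑ e ∈ G, x e α ^ 2 ≤ n ^ 2 := by
      rw [hT] at hlt'
      simp only at hlt'
      rw [← ENNReal.ofReal_sum_of_nonneg fun e _ => sq_nonneg _] at hlt'
      exact (ENNReal.ofReal_lt_ofReal_iff (by positivity)).mp hlt' |>.le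
    have h1 := hα f hf
    rw [hxS f hfS] at h1
    simp only at h1
    rw [h1]
    refine abs_le_of_sq_le_sq ?_ (mul_nonneg hn.le (apply_nonneg q f))
    calc (∑ e ∈ G, B f e * x e α) ^ 2 ≤ (∑ e ∈ G, B f e ^ 2) * ∑ e ∈ G, x e α ^ 2 :=
          Finset.sum_mul_sq_le_sq_mul_sq _ _ _
      _ ≤ q f ^ 2 * n ^ 2 := mul_le_mul (sum_sq_le_of_isFON hB hqB hG f) hle
          (Finset.sum_nonneg fun _ _ => sq_nonneg _) (sq_nonneg _)
      _ = (n * q f) ^ 2 := by ring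
  calc ν (boundedSet S q F n)ᶜ ≤ ν {α | ENNReal.ofReal (n ^ 2) ≤ T α} := measure_mono_ae hsub
    _ ≤ (∫⁻ α, T α ∂ν) / ENNReal.ofReal (n ^ 2) :=
        meas_ge_le_lintegral_div (Finset.measurable_fun_sum _ hxm).aemeasurable
          (ENNReal.ofReal_pos.mpr (by positivity)).ne' ENNReal.ofReal_ne_top
    _ ≤ _ := ENNReal.div_le_div_right hTint _

end Tightness

/-! ### Truncation and recovery of moments -/

section Truncation

/-- Truncation of an extended real at level `R`. -/
def truncEReal (R : ℝ) (t : EReal) : ℝ := (max ((-R : ℝ) : EReal) (min t (R : EReal))).toReal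

theorem truncEReal_coe (R t : ℝ) : truncEReal R (t : EReal) = max (-R) (min t R) := by
  have h : Monotone ((↑) : ℝ → EReal) := EReal.coe_strictMono.monotone
  rw [truncEReal, ← h.map_min, ← h.map_max, EReal.toReal_coe]

/-- Clamping first keeps the argument of `toReal` away from `⊥` and `⊤`, where `toReal` is
discontinuous. -/
theorem continuous_truncEReal (R : ℝ) : Continuous (truncEReal R) := by
  refine EReal.continuousOn_toReal.comp_continuous (by fun_prop) fun t => ?_
  simp only [Set.mem_compl_iff, Set.mem_insert_iff, Set.mem_singleton_iff, not_or]
  constructor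
  · exact ((EReal.bot_lt_coe (-R)).trans_le (le_max_left _ _)).ne'
  · exact (max_lt (EReal.coe_lt_top _) ((min_le_right _ _).trans_lt (EReal.coe_lt_top R))).ne

theorem abs_trunc_le {R : ℝ} (hR : 0 ≤ R) (t : ℝ) : |max (-R) (min t R)| ≤ |t| := by
  rcases abs_cases t with ⟨h, _⟩ | ⟨h, _⟩ <;> rw [h, abs_le] <;> constructor <;> grind

theorem abs_trunc_le_level {R : ℝ} (hR : 0 ≤ R) (t : ℝ) : |max (-R) (min t R)| ≤ R := by
  rw [abs_le]; constructor <;> grind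

/-- The error vanishes for `|t| ≤ R`; otherwise it is at most `|t|`, and `|t| ≤ t² / R`. -/
theorem abs_trunc_sub_le {R : ℝ} (hR : 0 < R) (t : ℝ) :
    |max (-R) (min t R) - t| ≤ t ^ 2 / R := by
  rw [le_div_iff₀ hR]
  rcases le_total t R with h | h
  · rw [min_eq_left h]
    rcases le_total (-R) t with h' | h'
    · rw [max_eq_right h']; simp; positivity
    · rw [max_eq_left h', abs_of_nonneg (by linarith)]; nlinarith
  · rw [min_eq_right h, max_eq_right (by linarith), abs_of_nonpos (by linarith)]; nlinarith

variable {X : Type*} [MeasurableSpace X]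

theorem integrable_trunc {ν : Measure X} [IsFiniteMeasure ν] {f : X → ℝ}
    (hf : AEStronglyMeasurable f ν) {R : ℝ} (hR : 0 ≤ R) :
    Integrable (fun x => max (-R) (min (f x) R)) ν := by
  refine Integrable.of_bound (C := R) ?_ (Eventually.of_forall fun x => abs_trunc_le_level hR _)
  exact (show Continuous fun t : ℝ => max (-R) (min t R) by fun_prop).comp_aestronglyMeasurable hf

theorem abs_integral_trunc_sub_le {ν : Measure X} [IsFiniteMeasure ν] {f : X → ℝ}
    (hf : Integrable f ν) (hf2 : Integrable (fun x => f x ^ 2) ν) {R : ℝ} (hR : 0 < R) :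
    |∫ x, max (-R) (min (f x) R) ∂ν - ∫ x, f x ∂ν| ≤ (∫ x, f x ^ 2 ∂ν) / R := by
  rw [← integral_sub (integrable_trunc hf.1 hR.le) hf, ← integral_div]
  exact norm_integral_le_of_norm_le (f := fun x => max (-R) (min (f x) R) - f x)
    (hf2.div_const R) (Eventually.of_forall fun x => abs_trunc_sub_le hR (f x))

theorem integral_abs_trunc_le {ν : Measure X} [IsFiniteMeasure ν] {f : X → ℝ}
    (hf : Integrable f ν) {R : ℝ} (hR : 0 ≤ R) :
    ∫ x, |max (-R) (min (f x) R)| ∂ν ≤ ∫ x, |f x| ∂ν :=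
  integral_mono (integrable_trunc hf.1 hR).abs hf.abs fun x => abs_trunc_le hR (f x)

theorem tendsto_trunc (t : ℝ) :
    Tendsto (fun n : ℕ => max (-(n : ℝ)) (min t n)) atTop (𝓝 t) := by
  refine tendsto_const_nhds.congr' ?_
  obtain ⟨N, hN⟩ := exists_nat_ge |t|
  filter_upwards [eventually_ge_atTop N] with n hn
  have h : |t| ≤ n := hN.trans (by exact_mod_cast hn)
  rw [abs_le] at h
  rw [min_eq_left h.2, max_eq_right h.1]

/-- Fatou's lemma gives integrability from the uniform bound `b`; dominated convergence then
identifies the integral as the limit of the truncated ones. -/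
theorem integrable_and_integral_eq_of_trunc {ν : Measure X} [IsFiniteMeasure ν] {f : X → ℝ}
    (hf : AEStronglyMeasurable f ν) {m s b : ℝ}
    (hb : ∀ n : ℕ, 0 < n → ∫ x, |max (-(n : ℝ)) (min (f x) n)| ∂ν ≤ b)
    (hm : ∀ n : ℕ, 0 < n → |∫ x, max (-(n : ℝ)) (min (f x) n) ∂ν - m| ≤ s / n) :
    Integrable f ν ∧ ∫ x, f x ∂ν = m := by
  have hint : Integrable f ν := by
    refine ⟨hf, ?_⟩
    have hlim : ∀ x, liminf (fun n : ℕ => ‖max (-(n : ℝ)) (min (f x) n)‖ₑ) atTop = ‖f x‖ₑ :=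
      fun x => (tendsto_trunc (f x)).enorm.liminf_eq
    have hmeas : ∀ n : ℕ, AEMeasurable (fun x => ‖max (-(n : ℝ)) (min (f x) n)‖ₑ) ν := fun n =>
      (integrable_trunc hf n.cast_nonneg).1.enorm
    have hle := lintegral_liminf_le' (μ := ν) (u := atTop) hmeas
    simp only [hlim] at hle
    refine (hle.trans (c := ENNReal.ofReal b) ?_).trans_lt ENNReal.ofReal_lt_top
    refine liminf_le_of_frequently_le' (Eventually.frequently ?_)
    filter_upwards [eventually_gt_atTop 0] with n hn
    rw [← ofReal_integral_norm_eq_lintegral_enorm (integrable_trunc hf n.cast_nonneg)]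
    exact ENNReal.ofReal_le_ofReal (hb n hn)
  refine ⟨hint, ?_⟩
  have h1 : Tendsto (fun n : ℕ => ∫ x, max (-(n : ℝ)) (min (f x) n) ∂ν) atTop
      (𝓝 (∫ x, f x ∂ν)) := by
    refine tendsto_integral_of_dominated_convergence (fun x => |f x|)
      (fun n => (integrable_trunc hf n.cast_nonneg).1) hint.abs
      (fun n => Eventually.of_forall fun x => abs_trunc_le n.cast_nonneg _)
      (Eventually.of_forall fun x => tendsto_trunc (f x))
  have h2 : Tendsto (fun n : ℕ => ∫ x, max (-(n : ℝ)) (min (f x) n) ∂ν) atTop (𝓝 m) := by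
    rw [tendsto_iff_dist_tendsto_zero]
    refine squeeze_zero' (Eventually.of_forall fun n => dist_nonneg) ?_
      (tendsto_const_div_atTop_nhds_zero_nat s)
    filter_upwards [eventually_gt_atTop 0] with n hn
    exact hm n hn
  exact tendsto_nhds_unique h1 h2

end Truncation

/-! ### Weak limits on compact Hausdorff spaces -/

section WeakLimit

variable {Y : Type*} [TopologicalSpace Y] [CompactSpace Y] [T2Space Y] [MeasurableSpace Y]
  [BorelSpace Y]

/-- The space of probability measures is compact, so the ultrafilter converges. `Y` need not be
metrizable, so the limit is exchanged for a regular measure with the same integrals of continuous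
functions. -/
theorem exists_regular_tendsto_ultrafilter {ι : Type*} (U : Ultrafilter ι)
    (P : ι → ProbabilityMeasure Y) :
    ∃ μ : Measure Y, μ.Regular ∧ IsFiniteMeasure μ ∧ ∀ g : C(Y, ℝ),
      Tendsto (fun i => ∫ y, g y ∂(P i : Measure Y)) U (𝓝 (∫ y, g y ∂μ)) := by
  obtain ⟨P₀, -, hP₀⟩ := isCompact_univ.ultrafilter_le_nhds' (U.map P) univ_mem
  obtain ⟨μ, hreg, hfin, hμ⟩ := Measure.exists_regular_eq_of_compactSpace (P₀ : Measure Y)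
  refine ⟨μ, hreg, hfin, fun g => ?_⟩
  have h := ProbabilityMeasure.tendsto_iff_forall_integral_tendsto.mp
    (show Tendsto P U (𝓝 P₀) from hP₀) (BoundedContinuousFunction.mkOfCompact g)
  rw [hμ] at h
  exact h

/-- The intersection may be uncountable, so continuity from above is replaced by inner regularity: a
compact `C` in the open complement already misses one `κ i`. A Urysohn function equal to 1 on `C`
and 0 on `κ i` compares `μ C` with the masses `P j (κ i)ᶜ` for `j ≥ i`. -/
theorem measure_compl_iInter_le {ι : Type*} [Preorder ι] [IsDirectedOrder ι] [Nonempty ι]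
    {l : Filter ι} [l.NeBot] (hl : l ≤ atTop) {P : ι → Measure Y} [∀ i, IsProbabilityMeasure (P i)]
    {μ : Measure Y} [μ.Regular] [IsFiniteMeasure μ]
    (hP : ∀ g : C(Y, ℝ), Tendsto (fun i => ∫ y, g y ∂P i) l (𝓝 (∫ y, g y ∂μ)))
    {κ : ι → Set Y} (hκ : ∀ i, IsClosed (κ i)) (hanti : Antitone κ) {ε : ℝ≥0∞}
    (hε : ∀ i j, i ≤ j → P j (κ i)ᶜ ≤ ε) : μ (⋂ i, κ i)ᶜ ≤ ε := by
  rcases eq_or_ne ε ⊤ with rfl | hεtop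
  · exact le_top
  rw [(isClosed_iInter hκ).isOpen_compl.measure_eq_iSup_isCompact]
  refine iSup₂_le fun C hC => iSup_le fun hCc => ?_
  obtain ⟨i, hi⟩ : ∃ i, Disjoint C (κ i) := by
    obtain ⟨i, hi⟩ := IsCompact.elim_directed_family_closed hCc κ hκ
      (Set.disjoint_iff_inter_eq_empty.mp (Set.disjoint_left.mpr fun x hx hx' => hC hx hx'))
      hanti.directed_ge
    exact ⟨i, Set.disjoint_iff_inter_eq_empty.mpr hi⟩
  obtain ⟨g, hg0, hg1, hg⟩ := exists_continuous_zero_one_of_isClosed (hκ i) hCc.isClosed hi.symm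
  have hgi : ∀ (ρ : Measure Y) [IsFiniteMeasure ρ], Integrable g ρ := fun ρ _ =>
    g.continuous.integrable_of_hasCompactSupport (HasCompactSupport.of_compactSpace _)
  have h1 : ∀ j, i ≤ j → ∫ y, g y ∂P j ≤ ε.toReal := by
    intro j hij
    calc ∫ y, g y ∂P j ≤ ∫ y, (κ i)ᶜ.indicator (fun _ => (1 : ℝ)) y ∂P j := by
          refine integral_mono (hgi _)
            ((integrable_const _).indicator (hκ i).measurableSet.compl) fun y => ?_
          by_cases hy : y ∈ κ i
          · simp [hy, hg0 hy]
          · simpa [hy] using (hg y).2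
      _ = (P j).real (κ i)ᶜ := by
          rw [integral_indicator_const _ (hκ i).measurableSet.compl]; simp
      _ ≤ ε.toReal := ENNReal.toReal_mono hεtop (hε i j hij)
  have h2 : ∫ y, g y ∂μ ≤ ε.toReal :=
    le_of_tendsto (hP g) (((eventually_ge_atTop i).filter_mono hl).mono h1)
  have h3 : μ.real C ≤ ∫ y, g y ∂μ := by
    calc μ.real C = ∫ y, C.indicator (fun _ => (1 : ℝ)) y ∂μ := by
          rw [integral_indicator_const _ hCc.measurableSet]; simp
      _ ≤ ∫ y, g y ∂μ := by
          refine integral_mono ((integrable_const _).indicator hCc.measurableSet) (hgi _)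
            fun y => ?_
          by_cases hy : y ∈ C
          · simp [hy, hg1 hy]
          · simpa [hy] using (hg y).1
  rw [← ENNReal.ofReal_toReal (measure_ne_top μ C), ← ENNReal.ofReal_toReal hεtop]
  exact ENNReal.ofReal_le_ofReal (h3.trans h2)

end WeakLimit

/-! ### Gluing over finite subsets and the limit measure -/

section ProjectiveSystem

variable {A : Type*} [CommRing A] [Algebra ℝ A] {V : Submodule ℝ A}

/-- The subalgebra generated by a finite subset of `V`. -/
def genSubalgebra (F : Finset V) : Subalgebra ℝ A :=
  Algebra.adjoin ℝ ((↑) '' (F : Set V) : Set A)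

theorem genSubalgebra_mem_finGenSubalgebras (F : Finset V) :
    genSubalgebra F ∈ finGenSubalgebras V := by
  refine ⟨Submodule.span ℝ ((↑) '' (F : Set V) : Set A), ?_, ?_, ?_⟩
  · rw [Submodule.span_le]
    rintro _ ⟨v, _, rfl⟩
    exact v.2
  · exact FiniteDimensional.span_of_finite ℝ (F.finite_toSet.image _)
  · rw [Algebra.adjoin_span]; rfl

theorem genSubalgebra_mono : Monotone (genSubalgebra (V := V)) := fun _ _ h =>
  Algebra.adjoin_mono (Set.image_mono (Finset.coe_subset.mpr h))

theorem mem_genSubalgebra {F : Finset V} {f : V} (hf : f ∈ F) : (f : A) ∈ genSubalgebra F :=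
  Algebra.subset_adjoin ⟨f, hf, rfl⟩

theorem exists_mem_genSubalgebra (hV : Algebra.adjoin ℝ (V : Set A) = ⊤) (a : A) :
    ∃ F : Finset V, a ∈ genSubalgebra F := by
  classical
  have ha : a ∈ Algebra.adjoin ℝ (V : Set A) := hV ▸ Algebra.mem_top
  induction ha using Algebra.adjoin_induction with
  | mem x hx => exact ⟨{⟨x, hx⟩}, mem_genSubalgebra (f := ⟨x, hx⟩) (by simp)⟩
  | algebraMap r => exact ⟨∅, Subalgebra.algebraMap_mem _ r⟩
  | add x y _ _ hx hy =>
    obtain ⟨F, hF⟩ := hx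
    obtain ⟨G, hG⟩ := hy
    exact ⟨F ∪ G, add_mem (genSubalgebra_mono Finset.subset_union_left hF)
      (genSubalgebra_mono Finset.subset_union_right hG)⟩
  | mul x y _ _ hx hy =>
    obtain ⟨F, hF⟩ := hx
    obtain ⟨G, hG⟩ := hy
    exact ⟨F ∪ G, mul_mem (genSubalgebra_mono Finset.subset_union_left hF)
      (genSubalgebra_mono Finset.subset_union_right hG)⟩

/-- The characters of `genSubalgebra F` that are nonnegative on `Q` and bounded by `n * q` on
`F`. -/
def localSet (Q : Set A) (q : Seminorm ℝ V) (n : ℝ) (F : Finset V) :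
    Set (CharSp (genSubalgebra F)) :=
  boundedSet (genSubalgebra F) q F n ∩ nonnegSet {s | (s : A) ∈ Q}

/-- The characters that are nonnegative on `Q` and bounded by `n * q` on `V`. -/
def globalSet (Q : Set A) (q : Seminorm ℝ V) (n : ℝ) : Set (CharSp A) :=
  {α | ∀ v : V, |α v| ≤ n * q v} ∩ nonnegSet Q

/-- The functions whose restriction to `genSubalgebra F` is a character in `localSet Q q n F`. -/
def cylinderSet (Q : Set A) (q : Seminorm ℝ V) (n : ℝ) (F : Finset V) : Set (ExtSp A) :=
  ExtSp.restrict (genSubalgebra F) ⁻¹' (CharSp.toExtSp '' localSet Q q n F)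

/-- The bounds on the generators `F` make the local set compact, so its image is closed although the
characters as a whole need not be closed in the extended-real functions. -/
theorem isClosed_cylinderSet (Q : Set A) (q : Seminorm ℝ V) (n : ℝ) (F : Finset V) :
    IsClosed (cylinderSet Q q n F) :=
  (((isCompact_boundedSet q (F : Set V) n).inter_right (isClosed_nonnegSet _)).image
    CharSp.isEmbedding_toExtSp.continuous).isClosed.preimage (ExtSp.continuous_restrict _)

theorem isClosed_globalSet (Q : Set A) (q : Seminorm ℝ V) (n : ℝ) :
    IsClosed (globalSet Q q n) := by
  refine IsClosed.inter ?_ (isClosed_nonnegSet _)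
  simp only [Set.ofPred_forall]
  exact isClosed_iInter fun v =>
    isClosed_le (CharSp.continuous_eval _).abs continuous_const

theorem isCompact_globalSet (hV : Algebra.adjoin ℝ (V : Set A) = ⊤) (Q : Set A)
    (q : Seminorm ℝ V) (n : ℝ) : IsCompact (globalSet Q q n) :=
  (isCompact_setOf_abs_le_seminorm hV q n).inter_right (isClosed_nonnegSet _)

theorem antitone_cylinderSet (Q : Set A) (q : Seminorm ℝ V) (n : ℝ) :
    Antitone (cylinderSet Q q n) := by
  intro F G h y hy
  obtain ⟨α, ⟨hαb, hαQ⟩, hα⟩ := hy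
  refine ⟨α.restrictLE (genSubalgebra_mono h), ⟨fun v hv hS => ?_, fun s hs => ?_⟩,
    ExtSp.ext fun s => ?_⟩
  · rw [CharSp.restrictLE_apply]
    exact hαb v (h hv) _
  · rw [CharSp.restrictLE_apply]
    exact hαQ ⟨s, genSubalgebra_mono h s.2⟩ hs
  · have hs := congrArg (ExtSp.eval ⟨(s : A), genSubalgebra_mono h s.2⟩) hα
    rw [CharSp.toExtSp_eval, ExtSp.restrict_eval] at hs
    rw [CharSp.toExtSp_eval, ExtSp.restrict_eval, CharSp.restrictLE_apply]
    exact hs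

theorem localSet_subset_preimage_extend (Q : Set A) (q : Seminorm ℝ V) (n : ℝ) (F : Finset V) :
    localSet Q q n F ⊆ CharSp.extend (genSubalgebra F) ⁻¹' cylinderSet Q q n F :=
  fun α hα => ⟨α, hα, (CharSp.restrict_extend α).symm⟩

/-- Any two elements of `A` lie in a common `genSubalgebra F`, on which `y` is a real-valued
character; hence `y` is finite and multiplicative everywhere. The bound at `v` is read off from `F =
{v}`. -/
theorem iInter_cylinderSet_subset (hV : Algebra.adjoin ℝ (V : Set A) = ⊤) (Q : Set A)
    (q : Seminorm ℝ V) (n : ℝ) :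
    ⋂ F, cylinderSet Q q n F ⊆ CharSp.toExtSp '' globalSet Q q n := by
  classical
  intro y hy
  rw [Set.mem_iInter] at hy
  choose α hα hαy using hy
  have hval : ∀ F (a : A) (ha : a ∈ genSubalgebra F),
      y.eval a = ((α F ⟨a, ha⟩ : ℝ) : EReal) := fun F a ha =>
    (congrArg (ExtSp.eval (⟨a, ha⟩ : genSubalgebra F)) (hαy F)).symm
  have hreal : ∀ F (a : A) (ha : a ∈ genSubalgebra F), (y.eval a).toReal = α F ⟨a, ha⟩ :=
    fun F a ha => by rw [hval F a ha, EReal.toReal_coe]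
  have hpair : ∀ a b : A, ∃ F : Finset V, a ∈ genSubalgebra F ∧ b ∈ genSubalgebra F := by
    intro a b
    obtain ⟨F, hF⟩ := exists_mem_genSubalgebra hV a
    obtain ⟨G, hG⟩ := exists_mem_genSubalgebra hV b
    exact ⟨F ∪ G, genSubalgebra_mono Finset.subset_union_left hF,
      genSubalgebra_mono Finset.subset_union_right hG⟩
  have halg : ∀ r : ℝ, (y.eval (algebraMap ℝ A r)).toReal = r := fun r => by
    rw [hreal ∅ _ (Subalgebra.algebraMap_mem _ r)]
    exact AlgHomClass.commutes (α ∅) r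
  let β : CharSp A := ({ toFun := fun a => (y.eval a).toReal
                         map_one' := by simpa using halg 1
                         map_zero' := by simpa using halg 0
                         map_mul' := fun a b => by
                           obtain ⟨F, ha, hb⟩ := hpair a b
                           rw [hreal F a ha, hreal F b hb, hreal F _ (mul_mem ha hb), ← map_mul]
                           rfl
                         map_add' := fun a b => by
                           obtain ⟨F, ha, hb⟩ := hpair a b
                           rw [hreal F a ha, hreal F b hb, hreal F _ (add_mem ha hb), ← map_add]
                           rfl
                         commutes' := halg } : A →ₐ[ℝ] ℝ)
  have hβ : ∀ a, β a = (y.eval a).toReal := fun a => rfl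
  refine ⟨β, ⟨fun v => ?_, fun a ha => ?_⟩, ExtSp.ext fun a => ?_⟩
  · have hv : (v : A) ∈ genSubalgebra {v} := mem_genSubalgebra (by simp)
    rw [hβ, hreal {v} v hv]
    exact (hα {v}).1 v (by simp) hv
  · obtain ⟨F, hF⟩ := exists_mem_genSubalgebra hV a
    rw [hβ, hreal F a hF]
    exact (hα F).2 ⟨a, hF⟩ ha
  · obtain ⟨F, hF⟩ := exists_mem_genSubalgebra hV a
    rw [CharSp.toExtSp_eval, hβ, hreal F a hF, hval F a hF]

/-- A finite regular measure on `ExtSp A` that is a weak limit of the finite-dimensional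
representing measures: it has the truncated moments of `L` in the limit and is concentrated, up to
the trace bound, on the bounded nonnegative characters. -/
theorem exists_limit_measure (hV : Algebra.adjoin ℝ (V : Set A) = ⊤) {L : A →ₗ[ℝ] ℝ}
    (hL1 : L 1 = 1) (hL : SumSqPositive L) (Q : Set A)
    (hfin : ∀ S ∈ finGenSubalgebras V, ∃ νS : Measure (CharSp S),
      IsRepresentingOn (L ∘ₗ S.val.toLinearMap) νS (nonnegSet {s : S | (s : A) ∈ Q}))
    {q : Seminorm ℝ V} (hq : IsHilbertian q) (htr : trace ((sL L hL).comp V.subtype) q < ⊤) :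
    ∃ μ : Measure (ExtSp A), μ.Regular ∧ IsFiniteMeasure μ ∧
      (∀ n : ℝ, 0 < n → μ (CharSp.toExtSp '' globalSet Q q n)ᶜ ≤
        trace ((sL L hL).comp V.subtype) q / ENNReal.ofReal (n ^ 2)) ∧
      ∀ (a : A) (n : ℝ), 0 < n → ∫ y, |truncEReal n (y.eval a)| ∂μ ≤ 1 + L (a ^ 2) ∧
        |∫ y, truncEReal n (y.eval a) ∂μ - L a| ≤ L (a ^ 2) / n := by
  classical
  choose ν hν using fun F : Finset V => hfin _ (genSubalgebra_mem_finGenSubalgebras F)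
  have hprob : ∀ F, IsProbabilityMeasure (ν F) := fun F =>
    isProbabilityMeasure_of_isRepresentingOn (hν F) (by simpa using hL1)
  have hext : ∀ F : Finset V, Measurable (CharSp.extend (genSubalgebra F)) := fun F =>
    (CharSp.continuous_extend _).measurable
  let P : Finset V → ProbabilityMeasure (ExtSp A) := fun F =>
    ⟨(ν F).map (CharSp.extend (genSubalgebra F)),
      Measure.isProbabilityMeasure_map (hext F).aemeasurable⟩
  have hPdef : ∀ F, (P F : Measure (ExtSp A)) = (ν F).map (CharSp.extend (genSubalgebra F)) :=
    fun F => rfl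
  let U : Ultrafilter (Finset V) := Ultrafilter.of atTop
  have hU : (U : Filter (Finset V)) ≤ atTop := Ultrafilter.of_le _
  obtain ⟨μ, hreg, hμfin, hμ⟩ := exists_regular_tendsto_ultrafilter U P
  refine ⟨μ, hreg, hμfin, fun n hn => ?_, fun a n hn => ?_⟩
  · refine (measure_mono (Set.compl_subset_compl.mpr
      (iInter_cylinderSet_subset hV Q q n))).trans ?_
    refine measure_compl_iInter_le hU (P := fun F => (P F : Measure (ExtSp A))) hμ
      (isClosed_cylinderSet Q q n) (antitone_cylinderSet Q q n) fun F G hFG => ?_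
    calc (P G : Measure (ExtSp A)) (cylinderSet Q q n F)ᶜ
        ≤ (P G : Measure (ExtSp A)) (cylinderSet Q q n G)ᶜ :=
          measure_mono (Set.compl_subset_compl.mpr (antitone_cylinderSet Q q n hFG))
      _ = ν G (CharSp.extend (genSubalgebra G) ⁻¹' (cylinderSet Q q n G)ᶜ) := by
          rw [hPdef, Measure.map_apply (hext G) (isClosed_cylinderSet Q q n G).measurableSet.compl]
      _ ≤ ν G (localSet Q q n G)ᶜ :=
          measure_mono (Set.compl_subset_compl.mpr (localSet_subset_preimage_extend Q q n G))
      _ ≤ ν G (boundedSet (genSubalgebra G) q G n)ᶜ +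
            ν G (nonnegSet {s : genSubalgebra G | (s : A) ∈ Q})ᶜ := by
          rw [localSet, Set.compl_inter]
          exact measure_union_le _ _
      _ ≤ _ := by
          rw [(hν G).null_compl, add_zero]
          exact measure_compl_boundedSet_le hL hq htr _ (hν G) G
            (fun f hf => mem_genSubalgebra hf) hn
  · obtain ⟨F₀, hF₀⟩ := exists_mem_genSubalgebra hV a
    -- The default value 0 of the extension at `a` occurs only outside a set belonging to `U`, so it
    -- does not affect the limit.
    have hev : ∀ᶠ F in (U : Filter (Finset V)), a ∈ genSubalgebra F :=
      ((eventually_ge_atTop F₀).filter_mono hU).mono fun F hF => genSubalgebra_mono hF hF₀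
    have hg : Continuous fun y : ExtSp A => truncEReal n (y.eval a) :=
      (continuous_truncEReal n).comp (ExtSp.continuous_eval a)
    have hPint : ∀ (g : C(ExtSp A, ℝ)) (F : Finset V), ∫ y, g y ∂(P F : Measure (ExtSp A)) =
        ∫ α, g (CharSp.extend (genSubalgebra F) α) ∂ν F := fun g F => by
      rw [hPdef, integral_map (hext F).aemeasurable g.continuous.aestronglyMeasurable]
    have hsqi : ∀ F (ha : a ∈ genSubalgebra F), Integrable (fun α : CharSp (genSubalgebra F) =>
        α ⟨a, ha⟩ ^ 2) (ν F) := fun F ha => by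
      have := (hν F).integrable (⟨a, ha⟩ ^ 2)
      simpa only [map_pow] using this
    have hsqv : ∀ F (ha : a ∈ genSubalgebra F), ∫ α, α ⟨a, ha⟩ ^ 2 ∂ν F = L (a ^ 2) :=
      fun F ha => by
        have := (hν F).integral_eq (⟨a, ha⟩ ^ 2)
        simp only [map_pow] at this
        rw [← this]
        simp
    constructor
    · refine le_of_tendsto (hμ ⟨_, hg.abs⟩) (hev.mono fun F ha => ?_)
      rw [hPint]
      simp only [ContinuousMap.coe_mk, CharSp.extend_eval _ ha, truncEReal_coe]
      refine (integral_abs_trunc_le ((hν F).integrable ⟨a, ha⟩) hn.le).trans ?_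
      -- From `|t| ≤ 1 + t²` and total mass 1 comes a bound independent of both `F` and `n`.
      calc ∫ α, |α ⟨a, ha⟩| ∂ν F ≤ ∫ α, (1 + α ⟨a, ha⟩ ^ 2) ∂ν F := by
            refine integral_mono ((hν F).integrable ⟨a, ha⟩).abs
              ((integrable_const 1).add (hsqi F ha)) fun α => ?_
            simp only
            nlinarith [sq_nonneg (|α ⟨a, ha⟩| - 1), sq_abs (α ⟨a, ha⟩)]
        _ = 1 + L (a ^ 2) := by
            rw [integral_add (integrable_const 1) (hsqi F ha), hsqv F ha]
            simp
    · refine le_of_tendsto ((hμ ⟨_, hg⟩).sub_const (L a)).abs (hev.mono fun F ha => ?_)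
      rw [hPint]
      simp only [ContinuousMap.coe_mk, CharSp.extend_eval _ ha, truncEReal_coe]
      have h := abs_integral_trunc_sub_le ((hν F).integrable ⟨a, ha⟩) (hsqi F ha) hn
      rw [hsqv F ha, ← (hν F).integral_eq ⟨a, ha⟩] at h
      exact h

/-- Integer continuity constants suffice. The countable union makes the support Borel, and σ-compact
when `V` generates `A`. -/
theorem nonneg_isContinuousOn_eq_iUnion (Q : Set A) (q : Seminorm ℝ V) :
    {α : CharSp A | α ∈ nonnegSet Q ∧ IsContinuousOn V q α} =
      ⋃ n : ℕ, globalSet Q q (n + 1 : ℝ) := by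
  ext α
  simp only [Set.mem_ofPred_eq, Set.mem_iUnion]
  constructor
  · rintro ⟨hQ, C, hC, hα⟩
    obtain ⟨n, hn⟩ := exists_nat_ge C
    exact ⟨n, fun v => (hα v).trans
      (mul_le_mul_of_nonneg_right (by linarith) (apply_nonneg q v)), hQ⟩
  · rintro ⟨n, hα, hQ⟩
    exact ⟨hQ, n + 1, by positivity, hα⟩

/-- The limit measure is transported through `Z` rather than directly to `CharSp A`: the image of
`Z` is σ-compact, hence Borel, which makes `j` a measurable embedding. -/
theorem exists_isRepresentingOn (hV : Algebra.adjoin ℝ (V : Set A) = ⊤) {L : A →ₗ[ℝ] ℝ}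
    (hL1 : L 1 = 1) (hL : SumSqPositive L) (Q : Set A)
    (hfin : ∀ S ∈ finGenSubalgebras V, ∃ νS : Measure (CharSp S),
      IsRepresentingOn (L ∘ₗ S.val.toLinearMap) νS (nonnegSet {s : S | (s : A) ∈ Q}))
    {q : Seminorm ℝ V} (hq : IsHilbertian q) (htr : trace ((sL L hL).comp V.subtype) q < ⊤) :
    ∃ ν : Measure (CharSp A),
      IsRepresentingOn L ν {α : CharSp A | α ∈ nonnegSet Q ∧ IsContinuousOn V q α} := by
  obtain ⟨μ, hreg, hμfin, hμK, hμL⟩ := exists_limit_measure hV hL1 hL Q hfin hq htr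
  rw [nonneg_isContinuousOn_eq_iUnion]
  set Z : Set (CharSp A) := ⋃ n : ℕ, globalSet Q q (n + 1 : ℝ) with hZ
  have hcpt : ∀ n : ℝ, IsCompact (CharSp.toExtSp '' globalSet Q q n) := fun n =>
    (isCompact_globalSet hV Q q n).image CharSp.isEmbedding_toExtSp.continuous
  set j : Z → ExtSp A := fun z => (z : CharSp A).toExtSp with hj
  have hjemb : IsEmbedding j := CharSp.isEmbedding_toExtSp.comp IsEmbedding.subtypeVal
  have hrange : Set.range j = ⋃ n : ℕ, CharSp.toExtSp '' globalSet Q q (n + 1 : ℝ) := by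
    rw [← Set.image_iUnion, ← hZ, hj, ← Set.image_eq_range]
  have hrangem : MeasurableSet (Set.range j) := by
    rw [hrange]
    exact MeasurableSet.iUnion fun n => (hcpt _).measurableSet
  have hjm : MeasurableEmbedding j := hjemb.measurableEmbedding hrangem
  have hnull : μ (Set.range j)ᶜ = 0 := by
    have hle : ∀ n : ℕ, μ (Set.range j)ᶜ ≤
        trace ((sL L hL).comp V.subtype) q / ENNReal.ofReal (((n : ℝ) + 1) ^ 2) := fun n => by
      refine (measure_mono (Set.compl_subset_compl.mpr ?_)).trans (hμK (n + 1) (by positivity))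
      rw [hrange]
      exact Set.subset_iUnion (fun n : ℕ => CharSp.toExtSp '' globalSet Q q (n + 1 : ℝ)) n
    have hlim : Tendsto (fun n : ℕ => trace ((sL L hL).comp V.subtype) q /
        ENNReal.ofReal (((n : ℝ) + 1) ^ 2)) atTop (𝓝 0) := by
      have h1 : Tendsto (fun n : ℕ => ENNReal.ofReal (((n : ℝ) + 1) ^ 2)) atTop (𝓝 ⊤) := by
        refine ENNReal.tendsto_ofReal_atTop.comp ((tendsto_pow_atTop two_ne_zero).comp ?_)
        exact tendsto_atTop_add_const_right _ _ tendsto_natCast_atTop_atTop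
      have h2 := ENNReal.Tendsto.const_div (a := trace ((sL L hL).comp V.subtype) q) h1
        (Or.inr htr.ne)
      simpa using h2
    exact le_antisymm (ge_of_tendsto' hlim hle) bot_le
  have hmap : (μ.comap j).map j = μ := by
    rw [hjm.map_comap, Measure.restrict_eq_self_of_ae_mem]
    exact hnull
  have hZm : MeasurableSet Z :=
    MeasurableSet.iUnion fun n => (isClosed_globalSet Q q _).measurableSet
  have hvm : MeasurableEmbedding (Subtype.val : Z → CharSp A) := MeasurableEmbedding.subtype_coe hZm
  have hfinc : IsFiniteMeasure (μ.comap j) := by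
    constructor
    rw [hjm.comap_apply]
    exact measure_lt_top _ _
  have hmom : ∀ a : A, Integrable (fun y : ExtSp A => (y.eval a).toReal) μ ∧
      ∫ y, (y.eval a).toReal ∂μ = L a := by
    intro a
    have hae : ∀ n : ℝ, ∀ᵐ y ∂μ,
        truncEReal n (y.eval a) = max (-n) (min ((y.eval a).toReal) n) := by
      -- Almost every point is a genuine character, so the extended-real truncation agrees with the
      -- real one.
      intro n
      filter_upwards [show ∀ᵐ y ∂μ, y ∈ Set.range j from hnull] with y hy
      obtain ⟨z, rfl⟩ := hy
      rw [hj, CharSp.toExtSp_eval, truncEReal_coe, EReal.toReal_coe]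
    refine integrable_and_integral_eq_of_trunc (f := fun y : ExtSp A => (y.eval a).toReal)
      (measurable_ereal_toReal.comp (ExtSp.continuous_eval a).measurable).aestronglyMeasurable
      (b := 1 + L (a ^ 2)) (s := L (a ^ 2)) (fun n hn => ?_) fun n hn => ?_
    · rw [← integral_congr_ae ((hae n).mono fun y hy => congrArg abs hy)]
      exact (hμL a n (by exact_mod_cast hn)).1
    · rw [← integral_congr_ae (hae n)]
      exact (hμL a n (by exact_mod_cast hn)).2
  refine ⟨(μ.comap j).map Subtype.val, ?_, ?_, fun a => ?_, fun a => ?_, ?_⟩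
  · infer_instance
  -- Regularity of the finite measure `μ` descends to `Z`, because compact subsets of the range of
  -- an embedding have compact preimage.
  · have hinner : (μ.comap j).InnerRegular := by
      refine ⟨Measure.InnerRegular.innerRegular.comap hjm
        (fun s hs => hjm.measurableSet_image.mpr hs) fun C hC hCc => ?_⟩
      exact (hjemb.isInducing.isCompact_preimage_iff hC).mpr hCc
    exact Measure.InnerRegular.map_of_continuous continuous_subtype_val
  · rw [hvm.integrable_map_iff]
    have h := (hmom a).1
    rw [← hmap, hjm.integrable_map_iff] at h
    exact h
  · have h := (hmom a).2
    rw [← hmap, hjm.integral_map] at h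
    rw [hvm.integral_map, ← h]
    rfl
  · rw [hvm.map_apply]
    convert measure_empty (μ := μ.comap j)
    ext z
    simp

end ProjectiveSystem

end MomentProblem

end

theorem mainTheorem9 {A : Type*} [CommRing A] [Algebra ℝ A]
    (V : Submodule ℝ A) [TopologicalSpace V]
    (hnuc : MomentProblem.IsNuclear V)
    (hgen : Algebra.adjoin ℝ (V : Set A) = ⊤)
    (K : Set (MomentProblem.CharSp A)) (hK : IsClosed K)
    (L : A →ₗ[ℝ] ℝ) (hL1 : L 1 = 1) (hLpos : MomentProblem.SumSqPositive L)
    (Q : Set A) (hQ : MomentProblem.IsQuadraticModule Q)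
    (hKQ : K = MomentProblem.nonnegSet Q)
    (hfin : ∀ S ∈ MomentProblem.finGenSubalgebras V,
      ∃ νS : MeasureTheory.Measure (MomentProblem.CharSp S),
        MomentProblem.IsRepresentingOn (L ∘ₗ S.val.toLinearMap) νS
          (MomentProblem.nonnegSet {s : S | (s : A) ∈ Q}))
    (hcont : Continuous fun v : V => MomentProblem.sL L hLpos (v : A))
    (q : Seminorm ℝ V) (hq : MomentProblem.IsHilbertian q)
    (hne : {α : MomentProblem.CharSp A |
      α ∈ MomentProblem.nonnegSet Q ∧ MomentProblem.IsContinuousOn V q α}.Nonempty)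
    (htr : MomentProblem.trace ((MomentProblem.sL L hLpos).comp V.subtype) q < ⊤) :
    ∃ ν : MeasureTheory.Measure (MomentProblem.CharSp A),
      MomentProblem.IsRepresentingOn L ν
        {α : MomentProblem.CharSp A | α ∈ K ∧ MomentProblem.IsContinuousOn V q α} := by
  subst hKQ
  exact MomentProblem.exists_isRepresentingOn hgen hL1 hLpos Q hfin hq htr
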